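/- Let $a<b$ be real numbers, $I=[a,b]$, let $n\ge 2$ and $k\in\{1,\dots,n-1\}$ be integers, and let $0\le\sigma_1<\dots<\sigma_k\le n-1$ and $0\le\varepsilon_1<\dots<\varepsilon_{n-k}\le n-1$ be integers satisfying condition $(N_a)$: $$\#\{j:\sigma_j<h\}+\#\{j:\varepsilon_j<h\}\ \ge\ h\qquad\text{for all }h\in\{1,\dots,n-1\}.$$ For $q\in\{1,\dots,n-1\}$ let $c_q$ and $d_q$ be the numbers of elements of $\{\sigma_1-q,\dots,\sigma_k-q\}\cap\{0,\dots,n-q-1\}$ and of $\{\varepsilon_1-q,\dots,\varepsilon_{n-k}-q\}\cap\{0,\dots,n-q-1\}$, respectively. For $M\in\mathbb R$ let $g_M:I\times I\to\mathbb R$ denote, when it exists, the Green's function of the operator $T_n[M]u=u^{(n)}+Mu$ on $I$ with boundary conditions $$u^{(\sigma_1)}(a)=\dots=u^{(\sigma_k)}(a)=0,\qquad u^{(\varepsilon_1)}(b)=\dots=u^{(\varepsilon_{n-k})}(b)=0;$$ that is: the partial derivatives $\partial^i g_M/\partial t^i$ exist and are continuous on $I\times I$ for $0\le i\le n-2$,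 and exist and are continuous on each of the triangles $a\le s<t\le b$ and $a\le t<s\le b$ for $i\le n$; for each $s\in(a,b)$ the function $g_M(\cdot,s)$ satisfies $T_n[M]g_M(\cdot,s)=0$ on $I\setminus\{s\}$ and the boundary conditions; and for each $s\in(a,b)$ the one-sided limits of $\partial^{n-1}g_M/\partial t^{n-1}(t,s)$ as $t\to s^{\pm}$ exist and satisfy $\frac{\partial^{n-1}}{\partial t^{n-1}}g_M(s^+,s)=\frac{\partial^{n-1}}{\partial t^{n-1}}g_M(s^-,s)+1$. Say that $\partial^q g_M/\partial t^q$ has constant sign on $I\times I$ if it is nonnegative at all points of $I\times I$ or nonpositive at all points of $I\times I$ (for $q=n-1$: at all points with $t\ne s$, where this derivative is defined). Let $q_1,q_2\in\{1,\dots,n-1\}$ with $q_1<q_2$ and $c_{q_1}+d_{q_1}=n-q_1$. If $M\in\mathbb R$ is such that $g_M$ exists and $\frac{\partial^{q_2}}{\partial t^{q_2}}g_M$ has constant sign on $I\times I$, then, for the same $M$, $\frac{\partial^{q_1}}{\partial t^{q_1}}g_M$ has constant sign on $I\times I$. -/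

import Mathlib

open scoped Topology

/-- Condition `(N_a)` for the sets of boundary indices `σ` (at `a`) and `ε` (at `b`). -/
def ConditionNa (n : ℕ) (σ ε : Finset ℕ) : Prop :=
  ∀ h : ℕ, 1 ≤ h → h ≤ n - 1 →
    h ≤ (σ.filter (fun i => i < h)).card + (ε.filter (fun i => i < h)).card

/-- The set `{σ₁ - q, …, σ_k - q} ∩ {0, …, n - q - 1}`, where the differences are taken in `ℤ`
(`j = σᵢ - q` is written as `j + q = σᵢ`). Its cardinality is `c_q`, respectively `d_q` when the
same construction is applied to the indices `ε` at `b`. -/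
def shiftedIndices (n q : ℕ) (σ : Finset ℕ) : Finset ℕ :=
  (Finset.range (n - q)).filter (fun j => j + q ∈ σ)

/-- `partialT a b q g t s` is `∂^q g / ∂t^q (t, s)`, for `g` regarded as a function on
`[a, b] × [a, b]` (so the derivatives at `t = a` and `t = b` are one-sided). -/
noncomputable def partialT (a b : ℝ) (q : ℕ) (g : ℝ → ℝ → ℝ) (t s : ℝ) : ℝ :=
  iteratedDerivWithin q (fun τ => g τ s) (Set.Icc a b) t

/-- `g` (restricted to `[a, b] × [a, b]`) is the scalar Green's function of the operator
`T_n[M] u = u^(n) + M u`, `n ≥ 2`, with the boundary conditions `u^(i)(a) = 0` for `i ∈ σ` and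
`u^(i)(b) = 0` for `i ∈ ε`. -/
structure IsGreenFunction (n : ℕ) (a b M : ℝ) (σ ε : Finset ℕ) (g : ℝ → ℝ → ℝ) : Prop where
  /-- For each `s`, `g(·, s)` is of class `C^(n-2)` on `[a, b]`. -/
  contDiffOn : ∀ s ∈ Set.Icc a b,
    ContDiffOn ℝ ((n - 2 : ℕ) : WithTop ℕ∞) (fun t => g t s) (Set.Icc a b)
  /-- The partial derivatives in `t` up to order `n - 2` are continuous on the whole square. -/
  continuousOn_square : ∀ i : ℕ, i ≤ n - 2 →
    ContinuousOn (fun p : ℝ × ℝ => partialT a b i g p.1 p.2) (Set.Icc a b ×ˢ Set.Icc a b)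
  /-- For each `s`, `g(·, s)` is of class `C^n` on `[a, s)` and on `(s, b]`. -/
  contDiffOn_off : ∀ s ∈ Set.Icc a b,
    ContDiffOn ℝ (n : WithTop ℕ∞) (fun t => g t s) (Set.Icc a b \ {s})
  /-- The partial derivatives in `t` up to order `n` are continuous on the two triangles
  `a ≤ s < t ≤ b` and `a ≤ t < s ≤ b`. -/
  continuousOn_triangles : ∀ i : ℕ, i ≤ n →
    ContinuousOn (fun p : ℝ × ℝ => partialT a b i g p.1 p.2)
      {p : ℝ × ℝ | p.1 ∈ Set.Icc a b ∧ p.2 ∈ Set.Icc a b ∧ p.1 ≠ p.2}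
  /-- `T_n[M] g(·, s) = 0` on `[a, b] \ {s}`. -/
  equation : ∀ s ∈ Set.Ioo a b, ∀ t ∈ Set.Icc a b, t ≠ s →
    partialT a b n g t s + M * g t s = 0
  /-- The derivative of order `n - 1` in `t` has one-sided limits at `t = s`, with jump `1`. -/
  jump : ∀ s ∈ Set.Ioo a b, ∃ l : ℝ,
    Filter.Tendsto (fun t => partialT a b (n - 1) g t s) (𝓝[<] s) (𝓝 l) ∧
    Filter.Tendsto (fun t => partialT a b (n - 1) g t s) (𝓝[>] s) (𝓝 (l + 1))
  /-- Boundary conditions at `a`. -/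
  boundary_left : ∀ s ∈ Set.Ioo a b, ∀ i ∈ σ, partialT a b i g a s = 0
  /-- Boundary conditions at `b`. -/
  boundary_right : ∀ s ∈ Set.Ioo a b, ∀ i ∈ ε, partialT a b i g b s = 0

/-- `∂^q g / ∂t^q` has constant sign on `[a, b] × [a, b]`: it is nonnegative at every point, or
nonpositive at every point. For `q = n - 1` the derivative does not exist on the diagonal `t = s`
(it has a jump there), so the diagonal is left out in that case only. -/
def HasConstantSign (n : ℕ) (a b : ℝ) (q : ℕ) (g : ℝ → ℝ → ℝ) : Prop :=
  (∀ t ∈ Set.Icc a b, ∀ s ∈ Set.Icc a b, (q = n - 1 → t ≠ s) → 0 ≤ partialT a b q g t s) ∨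
  (∀ t ∈ Set.Icc a b, ∀ s ∈ Set.Icc a b, (q = n - 1 → t ≠ s) → partialT a b q g t s ≤ 0)

/-! Fix `s` in `(a, b)`, write `F i` for the `i`-th `t`-derivative of `g(·, s)` and `N i` for the
number of boundary conditions of order below `i`. By Rolle, `r` alternating values of `F i` give `r
- 1` of `F (i + 1)`, plus one for each boundary zero of `F i`; so `1 + N i - i` alternations persist
from order to order. The equality for `q₁` says `N q₁ = q₁`, so a single nonzero value starts the
count, and `(N_a)` keeps it at least 1 up to `q₂`. A zero at `b` adds a point on the right and flips
the last sign. Hence a value of `F q₁` of the wrong sign forces one of `F q₂`. The resulting sign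
does not depend on `s`, and continuity reaches `s = a, b`. -/

/-- `f` takes nonzero values of alternating sign at `r` points of `[a, b]`, the rightmost of which
has the sign of `e`. The points `p 0 ≥ p 1 ≥ …` are numbered from right to left. -/
def AlternatesWithLastSign (a b : ℝ) (f : ℝ → ℝ) (r : ℕ) (e : ℝ) : Prop :=
  ∃ p : ℕ → ℝ, (∀ j < r, p j ∈ Set.Icc a b) ∧ (∀ j, j + 1 < r → p (j + 1) ≤ p j) ∧
    ∀ j < r, 0 < e * (-1) ^ j * f (p j)

/-- A form of the mean value theorem that allows one exceptional point. -/
theorem exists_pos_deriv_of_lt {f f' : ℝ → ℝ} {x y s : ℝ} (hxy : x ≤ y)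
    (hc : ContinuousOn f (Set.Icc x y))
    (hd : ∀ t ∈ Set.Ioo x y, t ≠ s → HasDerivAt f (f' t) t) (hlt : f x < f y) :
    ∃ t ∈ Set.Ioo x y, t ≠ s ∧ 0 < f' t := by
  have key : ∀ u v : ℝ, x ≤ u → u ≤ v → v ≤ y → s ∉ Set.Ioo u v → f u < f v →
      ∃ t ∈ Set.Ioo x y, t ≠ s ∧ 0 < f' t := by
    intro u v hxu huv hvy hs huv'
    have huv : u < v := lt_of_le_of_ne huv (by rintro rfl; exact lt_irrefl _ huv')
    have hne : ∀ t ∈ Set.Ioo u v, t ≠ s := fun t ht h => hs (h ▸ ht)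
    obtain ⟨t, ht, heq⟩ := exists_hasDerivAt_eq_slope f f' huv
      (hc.mono (Set.Icc_subset_Icc hxu hvy))
      (fun t ht => hd t (Set.Ioo_subset_Ioo hxu hvy ht) (hne t ht))
    exact ⟨t, Set.Ioo_subset_Ioo hxu hvy ht, hne t ht,
      heq ▸ div_pos (sub_pos.2 huv') (sub_pos.2 huv)⟩
  -- If `s` is interior, `f` must increase strictly across `[x, s]` or across `[s, y]`.
  by_cases hs : s ∈ Set.Ioo x y
  · rcases lt_or_ge (f x) (f s) with h | h
    · exact key x s le_rfl hs.1.le hs.2.le (fun h => lt_irrefl _ h.2) h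
    · exact key s y hs.1.le hs.2.le le_rfl (fun h => lt_irrefl _ h.1) (h.trans_lt hlt)
  · exact key x y le_rfl hxy le_rfl hs hlt

/-- Alternating increments of `f` yield alternating values of its derivative. -/
theorem AlternatesWithLastSign.of_increments {a b s e : ℝ} {f f' : ℝ → ℝ}
    (hc : ContinuousOn f (Set.Icc a b))
    (hd : ∀ t ∈ Set.Ioo a b, t ≠ s → HasDerivAt f (f' t) t) {r : ℕ} {p : ℕ → ℝ}
    (hp : ∀ j ≤ r, p j ∈ Set.Icc a b) (hmono : ∀ j < r, p (j + 1) ≤ p j)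
    (hinc : ∀ j < r, 0 < e * (-1) ^ j * (f (p j) - f (p (j + 1)))) :
    ∃ q : ℕ → ℝ, (∀ j < r, q j ∈ Set.Ioo a b ∧ q j ≠ s) ∧ (∀ j, j + 1 < r → q (j + 1) ≤ q j) ∧
      ∀ j < r, 0 < e * (-1) ^ j * f' (q j) := by
  have key : ∀ j, ∃ t, j < r → t ∈ Set.Ioo (p (j + 1)) (p j) ∧ t ≠ s ∧
      0 < e * (-1) ^ j * f' t := by
    intro j
    by_cases hj : j < r
    · have h1 := hp j hj.le
      have h2 := hp (j + 1) hj
      obtain ⟨t, ht⟩ := exists_pos_deriv_of_lt (f := fun t => e * (-1) ^ j * f t)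
        (f' := fun t => e * (-1) ^ j * f' t) (s := s) (hmono j hj)
        ((continuousOn_const.mul hc).mono (Set.Icc_subset_Icc h2.1 h1.2))
        (fun t ht hts => (hd t (Set.Ioo_subset_Ioo h2.1 h1.2 ht) hts).const_mul _)
        (by have := hinc j hj; rw [mul_sub] at this; linarith)
      exact ⟨t, fun _ => ht⟩
    · exact ⟨0, fun h => absurd h hj⟩
  choose q hq using key
  refine ⟨q, fun j hj => ⟨?_, (hq j hj).2.1⟩, fun j hj => ?_, fun j hj => (hq j hj).2.2⟩
  · exact Set.Ioo_subset_Ioo (hp (j + 1) hj).1 (hp j hj.le).2 (hq j hj).1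
  · exact ((hq (j + 1) hj).1.2.trans (hq j (by omega)).1.1).le

/-- Passing to the derivative costs one alternation; each boundary zero gains one, and a zero at the
right end point reverses the last sign. -/
theorem AlternatesWithLastSign.deriv {a b s e : ℝ} {f f' : ℝ → ℝ} (hab : a ≤ b)
    (hc : ContinuousOn f (Set.Icc a b))
    (hd : ∀ t ∈ Set.Ioo a b, t ≠ s → HasDerivAt f (f' t) t)
    {A B : Prop} [Decidable A] [Decidable B] (hA : A → f a = 0) (hB : B → f b = 0)
    {r r' : ℕ} (hr0 : 0 < r)
    (hr : r' + 1 = r + (if A then 1 else 0) + (if B then 1 else 0))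
    (h : AlternatesWithLastSign a b f r e) :
    ∃ q : ℕ → ℝ, (∀ j < r', q j ∈ Set.Ioo a b ∧ q j ≠ s) ∧
      (∀ j, j + 1 < r' → q (j + 1) ≤ q j) ∧
      ∀ j < r', 0 < e * (-1) ^ (if B then 1 else 0) * (-1) ^ j * f' (q j) := by
  obtain ⟨p, hp, hmono, hsign⟩ := h
  /- Extend the points by `a` on the left; the increments of the extended sequence alternate. -/
  let p₁ : ℕ → ℝ := fun j => if j < r then p j else a
  have hp₁ : ∀ j, p₁ j ∈ Set.Icc a b := by
    intro j
    by_cases hj : j < r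
    · simpa only [p₁, if_pos hj] using hp j hj
    · simp only [p₁, if_neg hj]; exact ⟨le_rfl, hab⟩
  have hmono₁ : ∀ j, p₁ (j + 1) ≤ p₁ j := by
    intro j
    by_cases hj : j + 1 < r
    · simpa only [p₁, if_pos hj, if_pos (show j < r by omega)] using hmono j hj
    · simp only [p₁, if_neg hj]; exact (hp₁ j).1
  -- The increment from `a` to the leftmost point counts only under `A`: then `f a = 0`, so it has
  -- the sign of `f` there.
  have hinc₁ : ∀ j, j + 1 < r + (if A then 1 else 0) →
      0 < e * (-1) ^ j * (f (p₁ j) - f (p₁ (j + 1))) := by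
    intro j hj
    have hjr : j < r := by split_ifs at hj <;> omega
    have h1 := hsign j hjr
    by_cases hj' : j + 1 < r
    · have h2 := hsign (j + 1) hj'
      simp only [p₁, if_pos hj', if_pos hjr]
      rw [pow_succ] at h2
      linarith
    · have hAt : A := by by_contra hA'; rw [if_neg hA'] at hj; omega
      simp only [p₁, if_neg hj', if_pos hjr, hA hAt, sub_zero]
      exact h1
  by_cases hBt : B
  · simp only [if_pos hBt, pow_one] at hr ⊢
    -- Prepending `b` shifts indices by one; as `f b = 0`, the new increment is `-f (p 0)`, whence
    -- the reversal of `e`.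
    refine AlternatesWithLastSign.of_increments hc hd (r := r')
      (p := fun j => Nat.casesOn j b p₁) ?_ ?_ ?_
    · rintro (_ | j) _
      · exact ⟨hab, le_rfl⟩
      · exact hp₁ j
    · rintro (_ | j) _
      · exact (hp₁ 0).2
      · exact hmono₁ j
    · rintro (_ | j) hj
      · have := hsign 0 hr0
        change 0 < e * -1 * (-1) ^ 0 * (f b - f (p₁ 0))
        simp only [p₁, if_pos hr0, hB hBt]
        simp only [pow_zero, mul_one] at this ⊢
        linarith
      · have := hinc₁ j (by omega)
        change 0 < e * -1 * (-1) ^ (j + 1) * (f (p₁ j) - f (p₁ (j + 1)))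
        rw [pow_succ]
        linarith
  · simp only [if_neg hBt, pow_zero, mul_one, add_zero] at hr ⊢
    exact AlternatesWithLastSign.of_increments hc hd (fun j _ => hp₁ j) (fun j _ => hmono₁ j)
      fun j hj => hinc₁ j (by omega)

/-! ### Counting boundary conditions -/

theorem card_filter_lt_succ (σ : Finset ℕ) (i : ℕ) :
    (σ.filter (fun x => x < i + 1)).card =
      (σ.filter (fun x => x < i)).card + if i ∈ σ then 1 else 0 := by
  simp only [Nat.lt_succ_iff_lt_or_eq, Finset.filter_or]
  rw [Finset.card_union_of_disjoint, Finset.filter_eq']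
  · split_ifs <;> simp
  · rw [Finset.disjoint_filter]
    intro x _ h1 h2
    omega

/-- Two-point boundary conditions that satisfy the counting condition, with equality at order `q`,
determine the sign of the derivative of order `q` from that of any derivative of higher order. -/
theorem exists_sign_of_ne_zero {a b s e : ℝ} (hab : a ≤ b) {F : ℕ → ℝ → ℝ} {σ ε : Finset ℕ}
    {q m : ℕ} (hqm : q < m)
    (hc : ∀ i, q ≤ i → i < m → ContinuousOn (F i) (Set.Icc a b))
    (hd : ∀ i, q ≤ i → i < m → ∀ t ∈ Set.Ioo a b, t ≠ s → HasDerivAt (F i) (F (i + 1) t) t)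
    (hσ : ∀ i ∈ σ, q ≤ i → i < m → F i a = 0) (hε : ∀ i ∈ ε, q ≤ i → i < m → F i b = 0)
    (hq : (σ.filter (fun x => x < q)).card + (ε.filter (fun x => x < q)).card = q)
    (hN : ∀ h, q < h → h ≤ m →
      h ≤ (σ.filter (fun x => x < h)).card + (ε.filter (fun x => x < h)).card)
    {t : ℝ} (ht : t ∈ Set.Icc a b)
    (hpos : 0 < e * (-1) ^ (ε.filter (fun x => x < q)).card * F q t) :
    ∃ x ∈ Set.Ioo a b, x ≠ s ∧ 0 < e * (-1) ^ (ε.filter (fun x => x < m)).card * F m x := by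
  -- Stated apart from `alt` because the last order needs points inside `(a, b)` and off `s`.
  have step : ∀ i, q ≤ i → i < m → ∀ r r' : ℕ, 0 < r →
      r + i = 1 + (σ.filter (fun x => x < i)).card + (ε.filter (fun x => x < i)).card →
      r' + (i + 1) =
        1 + (σ.filter (fun x => x < i + 1)).card + (ε.filter (fun x => x < i + 1)).card →
      AlternatesWithLastSign a b (F i) r (e * (-1) ^ (ε.filter (fun x => x < i)).card) →
      ∃ p : ℕ → ℝ, (∀ j < r', p j ∈ Set.Ioo a b ∧ p j ≠ s) ∧
        (∀ j, j + 1 < r' → p (j + 1) ≤ p j) ∧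
        ∀ j < r', 0 < e * (-1) ^ (ε.filter (fun x => x < i + 1)).card * (-1) ^ j *
          F (i + 1) (p j) := by
    intro i hqi him r r' hr0 hr hr' halt
    rw [card_filter_lt_succ ε, pow_add, ← mul_assoc e]
    rw [card_filter_lt_succ σ, card_filter_lt_succ ε] at hr'
    exact halt.deriv hab (hc i hqi him) (hd i hqi him) (A := i ∈ σ) (B := i ∈ ε)
      (fun h => hσ i h hqi him) (fun h => hε i h hqi him) hr0 (by omega)
  have alt : ∀ i, q ≤ i → i < m → ∀ r : ℕ,
      r + i = 1 + (σ.filter (fun x => x < i)).card + (ε.filter (fun x => x < i)).card →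
      AlternatesWithLastSign a b (F i) r (e * (-1) ^ (ε.filter (fun x => x < i)).card) := by
    intro i hqi
    induction i, hqi using Nat.le_induction with
    | base =>
      intro _ r hr
      obtain rfl : r = 1 := by omega
      refine ⟨fun _ => t, fun _ _ => ht, fun _ _ => le_rfl, fun j hj => ?_⟩
      obtain rfl : j = 0 := by omega
      simpa using hpos
    | succ i hqi ih =>
      intro him r' hr'
      have hi : i ≤ (σ.filter (fun x => x < i)).card + (ε.filter (fun x => x < i)).card := by
        rcases hqi.eq_or_lt with rfl | h
        · exact hq.ge
        · exact hN i h (by omega)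
      obtain ⟨p, h1, h2, h3⟩ := step i hqi (by omega)
        (1 + (σ.filter (fun x => x < i)).card + (ε.filter (fun x => x < i)).card - i) r'
        (by omega) (by omega) hr' (ih (by omega) _ (by omega))
      exact ⟨p, fun j hj => Set.Ioo_subset_Icc_self (h1 j hj).1, h2, h3⟩
  obtain ⟨i, rfl⟩ : ∃ i, m = i + 1 := ⟨m - 1, by omega⟩
  have hi : i ≤ (σ.filter (fun x => x < i)).card + (ε.filter (fun x => x < i)).card := by
    rcases (Nat.lt_succ_iff.1 hqm).eq_or_lt with rfl | h
    · exact hq.ge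
    · exact hN i h (by omega)
  have hi' := hN (i + 1) hqm le_rfl
  obtain ⟨p, h1, -, h3⟩ := step i (by omega) (by omega)
    (1 + (σ.filter (fun x => x < i)).card + (ε.filter (fun x => x < i)).card - i)
    (1 + (σ.filter (fun x => x < i + 1)).card + (ε.filter (fun x => x < i + 1)).card - (i + 1))
    (by omega) (by omega) (by omega) (alt i (by omega) (by omega) _ (by omega))
  have h0 : 0 < 1 + (σ.filter (fun x => x < i + 1)).card +
      (ε.filter (fun x => x < i + 1)).card - (i + 1) := by omega
  exact ⟨p 0, (h1 0 h0).1, (h1 0 h0).2, by simpa using h3 0 h0⟩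

/-- Shifting by `q` matches the shifted indices with the elements of `σ` that are at least `q`. This
turns the hypothesis on `c_q + d_q` into a count of the orders below `q`. -/
theorem card_shiftedIndices_add {n q : ℕ} (hq : q ≤ n) {σ : Finset ℕ} (hσ : σ ⊆ Finset.range n) :
    (shiftedIndices n q σ).card + (σ.filter (fun x => x < q)).card = σ.card := by
  have h : (shiftedIndices n q σ).card = (σ.filter (fun x => ¬ x < q)).card := by
    refine Finset.card_bij (fun j _ => j + q) ?_ (fun _ _ _ _ h => by omega) ?_
    · intro j hj
      simp only [shiftedIndices, Finset.mem_filter, Finset.mem_range] at hj ⊢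
      exact ⟨hj.2, by omega⟩
    · intro x hx
      simp only [shiftedIndices, Finset.mem_filter, Finset.mem_range] at hx ⊢
      have := Finset.mem_range.1 (hσ hx.1)
      exact ⟨x - q, ⟨by omega, by rw [Nat.sub_add_cancel (by omega)]; exact hx.1⟩, by omega⟩
  rw [h, add_comm, Finset.card_filter_add_card_filter_not]

/-! ### Regularity of the Green's function in each variable -/

namespace IsGreenFunction

variable {n : ℕ} {a b M : ℝ} {σ ε : Finset ℕ} {g : ℝ → ℝ → ℝ}

theorem continuousOn_partialT (hg : IsGreenFunction n a b M σ ε g) (hab : a < b) {s : ℝ}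
    (hs : s ∈ Set.Icc a b) {i : ℕ} (hi : i ≤ n - 2) :
    ContinuousOn (fun t => partialT a b i g t s) (Set.Icc a b) :=
  (hg.contDiffOn s hs).continuousOn_iteratedDerivWithin (by exact_mod_cast hi)
    (uniqueDiffOn_Icc hab)

theorem hasDerivAt_partialT (hg : IsGreenFunction n a b M σ ε g) (hab : a < b) {s : ℝ}
    (hs : s ∈ Set.Icc a b) {i : ℕ} (hi : i < n) {t : ℝ} (ht : t ∈ Set.Ioo a b) (hts : t ≠ s) :
    HasDerivAt (fun t => partialT a b i g t s) (partialT a b (i + 1) g t s) t := by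
  have htI := Set.Ioo_subset_Icc_self ht
  have hcd : ContDiffWithinAt ℝ n (fun τ => g τ s) (Set.Icc a b) t :=
    (hg.contDiffOn_off s hs t ⟨htI, hts⟩).mono_of_mem_nhdsWithin
      (Filter.inter_mem self_mem_nhdsWithin
        (mem_nhdsWithin_of_mem_nhds (isOpen_compl_singleton.mem_nhds hts)))
  have hdiff := hcd.differentiableWithinAt_iteratedDerivWithin (m := i) (by exact_mod_cast hi)
    (by rw [Set.insert_eq_of_mem htI]; exact uniqueDiffOn_Icc hab)
  simp only [partialT, iteratedDerivWithin_succ]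
  exact hdiff.hasDerivWithinAt.hasDerivAt (Icc_mem_nhds ht.1 ht.2)

/-- A sign that a partial derivative of order at most `n - 2` has for all `s` in the open interval
extends to the closed square. -/
theorem nonneg_of_forall_mem_Ioo (hg : IsGreenFunction n a b M σ ε g) (hab : a < b) {i : ℕ}
    (hi : i ≤ n - 2) {c t : ℝ} (ht : t ∈ Set.Icc a b)
    (h : ∀ s ∈ Set.Ioo a b, 0 ≤ c * partialT a b i g t s) {s : ℝ} (hs : s ∈ Set.Icc a b) :
    0 ≤ c * partialT a b i g t s := by
  have hcont : ContinuousOn (fun s => c * partialT a b i g t s) (Set.Icc a b) :=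
    continuousOn_const.mul ((hg.continuousOn_square i hi).comp
      (continuousOn_const.prodMk continuousOn_id) fun s hs => ⟨ht, hs⟩)
  have hcl : closure (Set.Ioo a b) = Set.Icc a b := closure_Ioo hab.ne
  rw [← hcl] at hcont hs
  exact le_on_closure h continuousOn_const hcont hs

end IsGreenFunction

theorem mainTheorem9 (n k : ℕ) (hk : 1 ≤ k) (hkn : k ≤ n - 1)
    (a b : ℝ) (hab : a < b)
    (σ ε : Finset ℕ) (hσ : σ ⊆ Finset.range n) (hε : ε ⊆ Finset.range n)
    (hσk : σ.card = k) (hεk : ε.card = n - k)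
    (hNa : ConditionNa n σ ε)
    (q₁ q₂ : ℕ) (hq₁ : 1 ≤ q₁) (hq : q₁ < q₂) (hq₂ : q₂ ≤ n - 1)
    (hcd : (shiftedIndices n q₁ σ).card + (shiftedIndices n q₁ ε).card = n - q₁)
    (M : ℝ) (g : ℝ → ℝ → ℝ) (hg : IsGreenFunction n a b M σ ε g)
    (hsign : HasConstantSign n a b q₂ g) :
    HasConstantSign n a b q₁ g := by
  have hcard : (σ.filter (fun x => x < q₁)).card + (ε.filter (fun x => x < q₁)).card = q₁ := by
    have h1 := card_shiftedIndices_add (q := q₁) (by omega) hσ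
    have h2 := card_shiftedIndices_add (q := q₁) (by omega) hε
    omega
  obtain ⟨e, he, hw⟩ : ∃ e : ℝ, (e = 1 ∨ e = -1) ∧ ∀ t ∈ Set.Icc a b, ∀ s ∈ Set.Icc a b,
      t ≠ s → 0 ≤ e * partialT a b q₂ g t s := by
    rcases hsign with h | h
    · exact ⟨1, Or.inl rfl, fun t ht s hs hts => by simpa using h t ht s hs fun _ => hts⟩
    · exact ⟨-1, Or.inr rfl, fun t ht s hs hts => by simpa using h t ht s hs fun _ => hts⟩
  set c₁ : ℝ := (-1) ^ (ε.filter (fun x => x < q₁)).card with hc₁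
  set c₂ : ℝ := (-1) ^ (ε.filter (fun x => x < q₂)).card with hc₂
  have hc₂sq : c₂ * c₂ = 1 := by rw [hc₂, ← mul_pow]; simp
  have hnonneg : ∀ t ∈ Set.Icc a b, ∀ s ∈ Set.Icc a b,
      0 ≤ e * c₂ * c₁ * partialT a b q₁ g t s := by
    intro t ht s hs
    -- Here `q₁ < q₂ ≤ n - 1` gives `q₁ ≤ n - 2`, so continuity in `s` is available.
    refine hg.nonneg_of_forall_mem_Ioo hab (by omega) ht (fun s hs => ?_) hs
    have hsI := Set.Ioo_subset_Icc_self hs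
    by_contra! hneg
    -- The factor `c₂` in the chosen sign cancels the one in the conclusion, leaving `-e` times the
    -- derivative positive at `x`.
    obtain ⟨x, hx, hxs, hxpos⟩ := exists_sign_of_ne_zero (s := s) (e := -(e * c₂)) hab.le
      (F := fun i t => partialT a b i g t s) (σ := σ) (ε := ε) hq
      (fun i _ hi => hg.continuousOn_partialT hab hsI (by omega))
      (fun i _ hi t ht hts => hg.hasDerivAt_partialT hab hsI (by omega) ht hts)
      (fun i hi _ _ => hg.boundary_left s hs i hi) (fun i hi _ _ => hg.boundary_right s hs i hi)
      hcard (fun h h1 h2 => hNa h (by omega) (by omega)) ht (by rw [← hc₁]; linarith)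
    have h1 := hw x (Set.Ioo_subset_Icc_self hx) s hsI hxs
    rw [← hc₂, neg_mul, mul_assoc e, hc₂sq] at hxpos
    linarith
  have hsgn : e * c₂ * c₁ = 1 ∨ e * c₂ * c₁ = -1 := by
    rcases he with rfl | rfl <;> rcases neg_one_pow_eq_or ℝ (ε.filter (fun x => x < q₁)).card
      with h1 | h1 <;> rcases neg_one_pow_eq_or ℝ (ε.filter (fun x => x < q₂)).card
      with h2 | h2 <;> rw [hc₁, hc₂, h1, h2] <;> norm_num
  rcases hsgn with h | h
  · exact Or.inl fun t ht s hs _ => by simpa [h] using hnonneg t ht s hs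
  · exact Or.inr fun t ht s hs _ => by simpa [h] using hnonneg t ht s hs
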